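/- Let $\Lambda$ be the set of strictly increasing continuous maps of $[0,1]$ onto itself, let $e$ be the identity of $[0,1]$, and for $\lambda\in\Lambda$ put $\|\lambda-e\|=\sup_{t}|\lambda(t)-t|$ and $\|\lambda\|^0=\sup_{s<s'}\left|\log\frac{\lambda(s')-\lambda(s)}{s'-s}\right|$. Let $D$ be the space of right-continuous functions $[0,1]\to\mathbb R$ with left limits, with the (Skorohod $J_1$) metric $$d^0_{J_1}(x,y)=\inf_{\lambda\in\Lambda}\max\Big\{\|\lambda\|^0,\ \sup_{s\in[0,1]}|x(s)-y(\lambda(s))|\Big\}$$ and its Borel $\sigma$-field $\mathcal D$. Let $D([0,1];D)$ be the space of functions $[0,1]\to D$ that are right-continuous and have left limits in $(D,d^0_{J_1})$, with the metric $$d(x,y)=\inf_{\lambda\in\Lambda}\max\Big\{\|\lambda-e\|,\ \sup_{t\in[0,1]}d^0_{J_1}\big(x(t),y(\lambda(t))\big)\Big\}$$ and its Borel $\sigma$-field. For $t_1,\dots,t_k\in[0,1]$ let $\pi_{t_1,\dots,t_k}(x)=(x(t_1),\dots,x(t_k))\in D^k$, where $D^k$ has the product topology and the product $\sigma$-field.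 For a probability measure $P$ on $D([0,1];D)$ let $T_P$ be the set of $t\in[0,1]$ such that $\pi_t$ is continuous at $P$-almost every $x\in D([0,1];D)$. Weak convergence, written $\Rightarrow$, means convergence of the integrals of every bounded continuous real function. **Theorem.** Let $(P_n)_{n\ge1}$ and $P$ be Borel probability measures on $D([0,1];D)$ such that $$P_n\circ\pi_{t_1,\dots,t_k}^{-1}\ \Rightarrow\ P\circ\pi_{t_1,\dots,t_k}^{-1}\quad\text{in } D^k,\qquad\text{for all } k\ge1 \text{ and } t_1,\dots,t_k\in T_P,$$ and such that $(P_n)_{n\ge1}$ is tight, i.e. for every $\eta>0$ there is a compact $K\subset D([0,1];D)$ with $P_n(K)\ge1-\eta$ for all $n$. Then $P_n\Rightarrow P$ on $D([0,1];D)$. -/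

import Mathlib

open MeasureTheory Filter Topology Set
open scoped unitInterval ENNReal BoundedContinuousFunction

/-- Functions `[0,1] → E` which are right-continuous and have left limits.
At `t = 0` the left-limit condition and at `t = 1` the right-continuity condition are void. -/
@[ext]
structure Cadlag (E : Type*) [TopologicalSpace E] where
  toFun : I → E
  rightCont : ∀ t : I, ContinuousWithinAt toFun (Ici t) t
  leftLim : ∀ t : I, ∃ l : E, Tendsto toFun (𝓝[<] t) (𝓝 l)

instance {E : Type*} [TopologicalSpace E] : CoeFun (Cadlag E) (fun _ => I → E) :=
  ⟨Cadlag.toFun⟩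

/-- The time changes: strictly increasing continuous maps of `[0,1]` onto itself. These are exactly
the order automorphisms of `[0,1]` (whose continuity is automatic). -/
abbrev TimeChange : Type := I ≃o I

/-- `‖l - e‖ = sup_t |l t - t|`, the uniform distance from `l` to the identity. -/
noncomputable def TimeChange.uniformSize (l : TimeChange) : ℝ≥0∞ :=
  ⨆ t : I, edist (l t) t

/-- `‖l‖⁰ = sup_{s < s'} |log ((l s' - l s) / (s' - s))|`, possibly infinite. -/
noncomputable def TimeChange.logSize (l : TimeChange) : ℝ≥0∞ :=
  ⨆ (s : I) (s' : I) (_ : s < s'),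
    ENNReal.ofReal |Real.log (((l s' : ℝ) - (l s : ℝ)) / ((s' : ℝ) - (s : ℝ)))|

/-- `inf_l max (size l) (sup_t d (x t) (y (l t)))`, the Skorohod-type distance associated with a
way `size` of measuring how far a time change is from the identity. It is recorded as an extended
metric; its values are finite when `E` is a metric space, càdlàg functions being bounded. -/
noncomputable def Cadlag.skorohodEDist {E : Type*} [EMetricSpace E] (size : TimeChange → ℝ≥0∞)
    (x y : Cadlag E) : ℝ≥0∞ :=
  ⨅ l : TimeChange, max (size l) (⨆ t : I, edist (x t) (y (l t)))

/-! ### The Skorohod-type distances are metrics -/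

theorem TimeChange.uniformSize_refl :
    TimeChange.uniformSize (OrderIso.refl I) = 0 := by
  simp [TimeChange.uniformSize]

theorem TimeChange.uniformSize_symm_le (l : TimeChange) :
    TimeChange.uniformSize l.symm ≤ TimeChange.uniformSize l := by
  refine iSup_le fun t => ?_
  have h := le_iSup (fun t : I => edist (l t) t) (l.symm t)
  simpa [edist_comm, TimeChange.uniformSize] using h

theorem TimeChange.uniformSize_trans_le (l m : TimeChange) :
    TimeChange.uniformSize (l.trans m)
      ≤ TimeChange.uniformSize l + TimeChange.uniformSize m := by
  refine iSup_le fun t => ?_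
  have h1 := le_iSup (fun t : I => edist (l t) t) t
  have h2 := le_iSup (fun t : I => edist (m t) t) (l t)
  calc edist ((l.trans m) t) t ≤ edist (m (l t)) (l t) + edist (l t) t := edist_triangle _ _ _
    _ ≤ TimeChange.uniformSize m + TimeChange.uniformSize l := add_le_add h2 h1
    _ = _ := add_comm _ _

theorem TimeChange.logSize_refl : TimeChange.logSize (OrderIso.refl I) = 0 := by
  simp only [TimeChange.logSize, ENNReal.iSup_eq_zero]
  intro s s' h
  have h' : (s : ℝ) < s' := h
  simp [div_self (sub_ne_zero.2 h'.ne')]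

theorem TimeChange.le_logSize (l : TimeChange) {s s' : I} (h : s < s') :
    ENNReal.ofReal |Real.log (((l s' : ℝ) - (l s : ℝ)) / ((s' : ℝ) - (s : ℝ)))|
      ≤ TimeChange.logSize l :=
  le_iSup_of_le s (le_iSup_of_le s' (le_iSup_of_le h le_rfl))

theorem TimeChange.logSize_symm_le (l : TimeChange) :
    TimeChange.logSize l.symm ≤ TimeChange.logSize l := by
  refine iSup_le fun s => iSup_le fun s' => iSup_le fun h => ?_
  have h2 : l.symm s < l.symm s' := l.symm.strictMono h
  have h3 := TimeChange.le_logSize l h2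
  rw [OrderIso.apply_symm_apply, OrderIso.apply_symm_apply] at h3
  rwa [← inv_div, Real.log_inv, abs_neg]

theorem TimeChange.logSize_trans_le (l m : TimeChange) :
    TimeChange.logSize (l.trans m) ≤ TimeChange.logSize l + TimeChange.logSize m := by
  refine iSup_le fun s => iSup_le fun s' => iSup_le fun h => ?_
  have hl : l s < l s' := l.strictMono h
  have hm : m (l s) < m (l s') := m.strictMono hl
  have p0 : (0 : ℝ) < (s' : ℝ) - s := sub_pos.2 h
  have p1 : (0 : ℝ) < (l s' : ℝ) - l s := sub_pos.2 hl
  have p2 : (0 : ℝ) < (m (l s') : ℝ) - m (l s) := sub_pos.2 hm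
  have e : Real.log (((m (l s') : ℝ) - m (l s)) / ((s' : ℝ) - s))
      = Real.log (((l s' : ℝ) - l s) / ((s' : ℝ) - s))
        + Real.log (((m (l s') : ℝ) - m (l s)) / ((l s' : ℝ) - l s)) := by
    rw [← Real.log_mul (div_pos p1 p0).ne' (div_pos p2 p1).ne']
    congr 1
    field_simp
  calc ENNReal.ofReal |Real.log (((m (l s') : ℝ) - m (l s)) / ((s' : ℝ) - s))|
      ≤ ENNReal.ofReal (|Real.log (((l s' : ℝ) - l s) / ((s' : ℝ) - s))|
        + |Real.log (((m (l s') : ℝ) - m (l s)) / ((l s' : ℝ) - l s))|) := by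
        rw [e]; exact ENNReal.ofReal_le_ofReal (abs_add_le _ _)
    _ ≤ _ := ENNReal.ofReal_add_le
    _ ≤ _ := add_le_add (TimeChange.le_logSize l h) (TimeChange.le_logSize m hl)

/-- `‖l - e‖ ≤ exp ‖l‖⁰ - 1`, in a form suited to `ℝ≥0∞`. -/
theorem TimeChange.uniformSize_le_of_logSize_le (l : TimeChange) {c : ℝ} (hc : 0 ≤ c)
    (h : TimeChange.logSize l ≤ ENNReal.ofReal c) :
    TimeChange.uniformSize l ≤ ENNReal.ofReal (Real.exp c - 1) := by
  refine iSup_le fun t => ?_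
  rw [edist_dist]
  refine ENNReal.ofReal_le_ofReal ?_
  have l0 : l 0 = 0 := l.map_bot
  rcases eq_or_lt_of_le (show (0 : I) ≤ t from t.2.1) with h0 | h0
  · rw [← h0, l0, dist_self]
    have := Real.add_one_le_exp c
    linarith
  · have h1 := (TimeChange.le_logSize l h0).trans h
    rw [ENNReal.ofReal_le_ofReal_iff hc, l0, abs_le] at h1
    simp only [Set.Icc.coe_zero, sub_zero] at h1
    have t0 : (0 : ℝ) < t := h0
    have t1 : (t : ℝ) ≤ 1 := t.2.2
    have lt0 : (0 : ℝ) < l t := by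
      have := l.strictMono h0
      rw [l0] at this
      exact this
    have hq : (0 : ℝ) < (l t : ℝ) / t := div_pos lt0 t0
    have up : (l t : ℝ) ≤ Real.exp c * t := by
      have := (Real.log_le_iff_le_exp hq).1 h1.2
      rwa [div_le_iff₀ t0] at this
    have lo : Real.exp (-c) * t ≤ l t := by
      have := (Real.le_log_iff_exp_le hq).1 h1.1
      rwa [le_div_iff₀ t0] at this
    have e1 : 1 ≤ Real.exp c := Real.one_le_exp hc
    have e2 : 2 - Real.exp c ≤ Real.exp (-c) := by
      have h1 := Real.add_one_le_exp c
      have h3 : Real.exp c * Real.exp (-c) = 1 := by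
        rw [← Real.exp_add, add_neg_cancel, Real.exp_zero]
      nlinarith [sq_nonneg (Real.exp c - 1), Real.exp_pos c]
    rw [Subtype.dist_eq, Real.dist_eq, abs_le]
    constructor <;> nlinarith

namespace Cadlag

variable {E : Type*} [EMetricSpace E] {size : TimeChange → ℝ≥0∞}

theorem skorohodEDist_self (h : size (OrderIso.refl I) = 0) (x : Cadlag E) :
    skorohodEDist size x x = 0 :=
  le_antisymm (iInf_le_of_le (OrderIso.refl I) (by simp [h])) bot_le

theorem skorohodEDist_comm_le (h : ∀ l : TimeChange, size l.symm ≤ size l) (x y : Cadlag E) :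
    skorohodEDist size x y ≤ skorohodEDist size y x := by
  refine le_iInf fun l => iInf_le_of_le l.symm (max_le_max (h l) (iSup_le fun t => ?_))
  have := le_iSup (fun t : I => edist (y t) (x (l t))) (l.symm t)
  simpa [edist_comm] using this

theorem skorohodEDist_triangle (h : ∀ l m : TimeChange, size (l.trans m) ≤ size l + size m)
    (x y z : Cadlag E) :
    skorohodEDist size x z ≤ skorohodEDist size x y + skorohodEDist size y z := by
  unfold skorohodEDist
  rw [ENNReal.iInf_add]
  refine le_iInf fun l => ?_
  rw [ENNReal.add_iInf]
  refine le_iInf fun m => iInf_le_of_le (l.trans m) (max_le ?_ (iSup_le fun t => ?_))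
  · exact (h l m).trans (add_le_add (le_max_left _ _) (le_max_left _ _))
  · refine (edist_triangle (x t) (y (l t)) (z (m (l t)))).trans
      (add_le_add (le_max_of_le_right ?_) (le_max_of_le_right ?_))
    · exact le_iSup (fun t : I => edist (x t) (y (l t))) t
    · exact le_iSup (fun t : I => edist (y t) (z (m t))) (l t)

theorem eq_of_skorohodEDist_eq_zero
    (h : ∀ ε : ℝ≥0∞, 0 < ε → ∃ δ > 0, ∀ l : TimeChange, size l < δ →
      TimeChange.uniformSize l < ε)
    (x y : Cadlag E) (hxy : skorohodEDist size x y = 0) : x = y := by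
  have key : ∀ ε : ℝ≥0∞, 0 < ε → ∃ l : TimeChange,
      (∀ t, edist (l t) t < ε) ∧ ∀ t, edist (x t) (y (l t)) < ε := by
    intro ε hε
    obtain ⟨δ, hδ, H⟩ := h ε hε
    have : skorohodEDist size x y < min δ ε := hxy ▸ lt_min hδ hε
    obtain ⟨l, hl⟩ := iInf_lt_iff.1 this
    have h1 := H l ((le_max_left _ _).trans_lt (hl.trans_le (min_le_left _ _)))
    have h2 := (le_max_right _ _).trans_lt (hl.trans_le (min_le_right _ _))
    exact ⟨l, fun t => (le_iSup (fun t : I => edist (l t) t) t).trans_lt h1,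
      fun t => (le_iSup (fun t : I => edist (x t) (y (l t))) t).trans_lt h2⟩
  ext t
  rw [← edist_eq_zero]
  refine le_antisymm (ENNReal.le_of_forall_pos_le_add fun η hη _ => ?_) bot_le
  rw [zero_add]
  have hη3 : (0 : ℝ≥0∞) < η / 3 := ENNReal.div_pos (by exact_mod_cast hη.ne') (by simp)
  rcases eq_or_lt_of_le (show t ≤ 1 from t.2.2) with h1 | h1
  · obtain ⟨l, -, hl⟩ := key η (by exact_mod_cast hη)
    have l1 : l 1 = 1 := l.map_top
    have := hl 1
    rw [l1] at this
    rw [h1]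
    exact this.le
  · have hx := EMetric.tendsto_nhds.1 (x.rightCont t) _ hη3
    have hy := EMetric.tendsto_nhds.1 (y.rightCont t) _ hη3
    obtain ⟨r, hr, H⟩ := (EMetric.mem_nhdsWithin_iff).1 (hx.and hy)
    -- pick `u` slightly to the right of `t`, and a time change that moves it less than `u - t`
    obtain ⟨u, hu, htu⟩ : ∃ u : I, edist u t < r / 2 ∧ t < u := by
      have hne : (𝓝[>] t).NeBot := by
        refine nhdsGT_neBot_of_exists_gt ⟨1, h1⟩
      have hb : ∀ᶠ u in 𝓝[>] t, edist u t < r / 2 :=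
        mem_nhdsWithin_of_mem_nhds (Metric.eball_mem_nhds t (ENNReal.half_pos hr.ne'))
      exact (hb.and self_mem_nhdsWithin).exists
    have hpos : (0 : ℝ≥0∞) < edist u t := edist_pos.2 htu.ne'
    obtain ⟨l, hl, hxl⟩ := key (min (η / 3) (edist u t)) (lt_min hη3 hpos)
    have hlu := (hl u).trans_le (min_le_right _ _)
    have hge : t ≤ l u := by
      by_contra hcon
      push Not at hcon
      refine absurd hlu (not_lt.2 ?_)
      have c1 : (l u : ℝ) < t := hcon
      have c2 : (t : ℝ) < u := htu
      rw [edist_dist, edist_dist, Subtype.dist_eq, Subtype.dist_eq, Real.dist_eq, Real.dist_eq]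
      refine ENNReal.ofReal_le_ofReal ?_
      rw [abs_of_pos (by linarith), abs_of_neg (by linarith)]
      linarith
    have hlt : edist (l u) t < r := by
      calc edist (l u) t ≤ edist (l u) u + edist u t := edist_triangle _ _ _
        _ < r / 2 + r / 2 := ENNReal.add_lt_add (hlu.trans hu) hu
        _ = r := ENNReal.add_halves r
    have A := (H ⟨hu.trans_le ENNReal.half_le_self, htu.le⟩).1
    have B := (H ⟨hlt, hge⟩).2
    have C := (hxl u).trans_le (min_le_left _ _)
    calc edist (x t) (y t) ≤ edist (x t) (x u) + edist (x u) (y (l u)) + edist (y (l u)) (y t) :=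
          edist_triangle4 _ _ _ _
      _ ≤ η / 3 + η / 3 + η / 3 := by
          refine add_le_add (add_le_add ?_ C.le) B.le
          rw [edist_comm]; exact A.le
      _ = η := ENNReal.add_thirds _

/-- The distance `inf_l max ‖l - e‖ (sup_t d (x t) (y (l t)))`. -/
@[reducible]
noncomputable def uniformSkorohod (E : Type*) [EMetricSpace E] : EMetricSpace (Cadlag E) where
  edist := skorohodEDist TimeChange.uniformSize
  edist_self := skorohodEDist_self TimeChange.uniformSize_refl
  edist_comm x y := le_antisymm
    (skorohodEDist_comm_le TimeChange.uniformSize_symm_le x y)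
    (skorohodEDist_comm_le TimeChange.uniformSize_symm_le y x)
  edist_triangle := skorohodEDist_triangle TimeChange.uniformSize_trans_le
  eq_of_edist_eq_zero {x y} :=
    eq_of_skorohodEDist_eq_zero (fun ε hε => ⟨ε, hε, fun _ h => h⟩) x y

/-- The distance `inf_l max ‖l‖⁰ (sup_t d (x t) (y (l t)))`. -/
@[reducible]
noncomputable def logSkorohod (E : Type*) [EMetricSpace E] : EMetricSpace (Cadlag E) where
  edist := skorohodEDist TimeChange.logSize
  edist_self := skorohodEDist_self TimeChange.logSize_refl
  edist_comm x y := le_antisymm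
    (skorohodEDist_comm_le TimeChange.logSize_symm_le x y)
    (skorohodEDist_comm_le TimeChange.logSize_symm_le y x)
  edist_triangle := skorohodEDist_triangle TimeChange.logSize_trans_le
  eq_of_edist_eq_zero {x y} := by
    refine eq_of_skorohodEDist_eq_zero (fun ε hε => ?_) x y
    have hcont : Tendsto (fun c : ℝ => ENNReal.ofReal (Real.exp c - 1)) (𝓝[>] 0) (𝓝 0) := by
      have : Continuous fun c : ℝ => ENNReal.ofReal (Real.exp c - 1) :=
        ENNReal.continuous_ofReal.comp (by fun_prop)
      simpa using (this.tendsto 0).mono_left nhdsWithin_le_nhds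
    obtain ⟨c, hc, hc0⟩ := ((hcont.eventually_lt_const hε).and self_mem_nhdsWithin).exists
    exact ⟨ENNReal.ofReal c, ENNReal.ofReal_pos.2 hc0, fun l hl =>
      (l.uniformSize_le_of_logSize_le (le_of_lt hc0) hl.le).trans_lt hc⟩

end Cadlag

/-! ### The spaces `D` and `D([0,1]; D)` -/

/-- The Skorohod space `D` of real càdlàg functions on `[0,1]`. -/
def SkorohodD : Type := Cadlag ℝ

/-- `D` carries the complete `J₁` metric
`d⁰(x, y) = inf_l max ‖l‖⁰ (sup_s |x s - y (l s)|)`. -/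
noncomputable instance : EMetricSpace SkorohodD := Cadlag.logSkorohod ℝ

noncomputable instance : MeasurableSpace SkorohodD := borel SkorohodD

instance : BorelSpace SkorohodD := ⟨rfl⟩

/-- The space `D([0,1]; D)` of functions `[0,1] → D` which are right-continuous and have left limits
with respect to `J₁`. -/
def SkorohodDD : Type := Cadlag SkorohodD

/-- `D([0,1]; D)` carries the Skorohod metric
`d(x, y) = inf_l max ‖l - e‖ (sup_t d⁰(x t, y (l t)))`. -/
noncomputable instance : EMetricSpace SkorohodDD := Cadlag.uniformSkorohod SkorohodD

noncomputable instance : MeasurableSpace SkorohodDD := borel SkorohodDD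

instance : BorelSpace SkorohodDD := ⟨rfl⟩

namespace SkorohodDD

/-- The projection `x ↦ x t`. -/
def proj (t : I) (x : SkorohodDD) : SkorohodD := Cadlag.toFun x t

/-- The projection `x ↦ (x t₁, …, x tₖ)`. -/
def projs {k : ℕ} (t : Fin k → I) (x : SkorohodDD) : Fin k → SkorohodD := fun i => proj (t i) x

theorem exists_timeChange {x y : SkorohodDD} {ε : ℝ≥0∞} (h : edist x y < ε) :
    ∃ l : TimeChange, (∀ t, edist (l t) t < ε) ∧ ∀ t, edist (proj t x) (proj (l t) y) < ε := by
  obtain ⟨l, hl⟩ := iInf_lt_iff.1 h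
  exact ⟨l, fun t => (le_iSup (fun t : I => edist (l t) t) t).trans_lt
      ((le_max_left _ _).trans_lt hl),
    fun t => (le_iSup (fun t : I => edist (proj t x) (proj (l t) y)) t).trans_lt
      ((le_max_right _ _).trans_lt hl)⟩

/-- The paths which stay in a closed set during an open time interval form a closed set. -/
theorem isClosed_setOf_proj_mem {F : Set SkorohodD} (hF : IsClosed F) {J : Set I}
    (hJ : IsOpen J) : IsClosed {x : SkorohodDD | ∀ s ∈ J, proj s x ∈ F} := by
  refine isClosed_of_closure_subset fun x hx s hs => ?_
  rw [← hF.closure_eq, EMetric.mem_closure_iff]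
  intro ε hε
  obtain ⟨r, hr, hrJ⟩ := EMetric.isOpen_iff.1 hJ s hs
  obtain ⟨y, hy, hxy⟩ := EMetric.mem_closure_iff.1 hx (min ε r) (lt_min hε hr)
  obtain ⟨l, h1, h2⟩ := exists_timeChange hxy
  exact ⟨proj (l s) y, hy _ (hrJ ((h1 s).trans_le (min_le_right _ _))),
    (h2 s).trans_le (min_le_left _ _)⟩

theorem continuous_proj_one : Continuous (proj 1) := by
  refine EMetric.continuous_iff.2 fun x ε hε => ⟨ε, hε, fun y hy => ?_⟩
  obtain ⟨l, -, h2⟩ := exists_timeChange hy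
  have l1 : l 1 = 1 := l.map_top
  simpa [l1] using h2 1

theorem measurable_proj (t : I) : Measurable (proj t) := by
  rcases eq_or_lt_of_le (show t ≤ 1 from t.2.2) with h1 | h1
  · rw [h1]
    exact continuous_proj_one.measurable
  have hne : (𝓝[>] t).NeBot := nhdsGT_neBot_of_exists_gt ⟨1, h1⟩
  refine measurable_of_isOpen fun U hU => ?_
  let F : ℕ → Set SkorohodD := fun n => {p | (n : ℝ≥0∞)⁻¹ ≤ Metric.infEDist p Uᶜ}
  have hFc : ∀ n, IsClosed (F n) := fun n => isClosed_le continuous_const Metric.continuous_infEDist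
  have hFU : ∀ n, F n ⊆ U := by
    intro n p hp
    by_contra hpU
    have h0 : Metric.infEDist p Uᶜ = 0 := Metric.infEDist_zero_of_mem hpU
    have h2 : (n : ℝ≥0∞)⁻¹ ≤ 0 := h0 ▸ hp
    simp at h2
  have hset : proj t ⁻¹' U = ⋃ (n : ℕ) (m : ℕ),
      {x : SkorohodDD | ∀ s ∈ Ioi t ∩ Metric.eball t ((m : ℝ≥0∞)⁻¹), proj s x ∈ F n} := by
    ext x
    have hright : Tendsto (fun s => proj s x) (𝓝[≥] t) (𝓝 (proj t x)) := Cadlag.rightCont x t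
    simp only [mem_preimage, mem_iUnion, mem_ofPred_eq]
    constructor
    · intro hx
      have hpos : Metric.infEDist (proj t x) Uᶜ ≠ 0 := by
        intro h0
        rcases Set.eq_empty_or_nonempty Uᶜ with he | he
        · rw [he, Metric.infEDist_empty] at h0
          exact ENNReal.top_ne_zero h0
        · have := Metric.mem_closure_iff_infEDist_zero.2 h0
          rw [hU.isClosed_compl.closure_eq] at this
          exact this hx
      obtain ⟨n, hn⟩ := ENNReal.exists_inv_nat_lt hpos
      have hV : IsOpen {p : SkorohodD | (n : ℝ≥0∞)⁻¹ < Metric.infEDist p Uᶜ} :=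
        isOpen_lt continuous_const Metric.continuous_infEDist
      obtain ⟨r, hr, H⟩ := EMetric.mem_nhdsWithin_iff.1 (hright (hV.mem_nhds hn))
      obtain ⟨m, hm⟩ := ENNReal.exists_inv_nat_lt hr.ne'
      refine ⟨n, m, fun s hs => ?_⟩
      have hst : t ≤ s := le_of_lt hs.1
      have hsr : edist s t < r := lt_trans hs.2 hm
      exact le_of_lt (show (n : ℝ≥0∞)⁻¹ < Metric.infEDist (proj s x) Uᶜ from H ⟨hsr, hst⟩)
    · rintro ⟨n, m, h⟩
      refine hFU n ((hFc n).mem_of_tendsto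
        (hright.mono_left (nhdsWithin_mono t Ioi_subset_Ici_self)) ?_)
      have hball : Metric.eball t ((m : ℝ≥0∞)⁻¹) ∈ 𝓝[>] t :=
        mem_nhdsWithin_of_mem_nhds (Metric.eball_mem_nhds t (by simp))
      filter_upwards [hball, self_mem_nhdsWithin] with s h1 h2
      exact h s ⟨h2, h1⟩
  rw [hset]
  exact MeasurableSet.iUnion fun n => MeasurableSet.iUnion fun m =>
    (isClosed_setOf_proj_mem (hFc n) (isOpen_Ioi.inter Metric.isOpen_eball)).measurableSet

theorem measurable_projs {k : ℕ} (t : Fin k → I) : Measurable (projs t) :=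
  measurable_pi_lambda _ fun i => measurable_proj (t i)

/-- `T_P`: the times `t` at which the projection `x ↦ x t` is `P`-almost surely continuous, i.e.
`P`-almost every `x` is a continuity point of it. -/
def contTimes (P : Measure SkorohodDD) : Set I :=
  {t | ∀ᵐ x ∂P, ContinuousAt (proj t) x}

end SkorohodDD

/-- Weak convergence of a sequence of (probability) measures: the integrals of every bounded
continuous real function converge. -/
def WeaklyConverges {X : Type*} [TopologicalSpace X] [MeasurableSpace X]
    (P : ℕ → Measure X) (Q : Measure X) : Prop :=
  ∀ f : X →ᵇ ℝ, Tendsto (fun n => ∫ x, f x ∂(P n)) atTop (𝓝 (∫ x, f x ∂Q))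

/-! ### Weak convergence from tightness and convergence of moments -/

/-! Evaluation at a fixed time is not continuous on a Skorohod space, but time averages are:
Skorohod convergence gives convergence of values at 1 and at every continuity time of the limit,
hence at all but countably many times. So the functionals `∫ g (x s) dν(s)`, with `ν` the point mass
at 1 or Lebesgue measure on a basic open set, are continuous (`Cadlag.tendsto_avg`), and by
right-continuity they determine `x` (`Cadlag.eq_of_avg_eq`). With `g` the sigmoid this gives a
countable separating family of continuous functions on `D`; with `g` running over that family, the
same construction gives one on `D([0,1]; D)`.

By Fubini, a joint moment of these functionals is an integral over times `s` of expectations of a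
continuous function of `(x s₁, …, x sₖ)`. Almost every time lies in `T_P` (`ae_mem_contTimes`), so
the finite-dimensional hypothesis and dominated convergence yield convergence of all moments.

The family embeds the space continuously and injectively in a cube, where Stone–Weierstrass turns
convergence of moments into weak convergence. Tightness brings this back: on a compact `K` the
injection is a homeomorphism onto its image, so a bounded continuous function agrees on `K` with one
coming from the cube. Neither relative compactness of tight families nor subsequences are needed. -/

theorem tendsto_of_forall_approx {a : ℕ → ℝ} {a' : ℝ}
    (h : ∀ ε > 0, ∃ (b : ℕ → ℝ) (b' : ℝ), Tendsto b atTop (𝓝 b') ∧ (∀ n, |a n - b n| ≤ ε) ∧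
      |a' - b'| ≤ ε) : Tendsto a atTop (𝓝 a') := by
  rw [Metric.tendsto_atTop]
  intro ε hε
  obtain ⟨b, b', hb, h1, h2⟩ := h (ε / 4) (by positivity)
  obtain ⟨N, hN⟩ := Metric.tendsto_atTop.1 hb (ε / 4) (by positivity)
  refine ⟨N, fun n hn => ?_⟩
  have h3 := hN n hn
  have h4 := h1 n
  rw [Real.dist_eq, abs_lt] at *
  rw [abs_le] at h2 h4
  constructor <;> linarith [h3.1, h3.2, h2.1, h2.2, h4.1, h4.2]

/-- The convergence of the integrals of all monomials in the coordinates of a cube implies that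
of the integrals of all continuous functions. -/
theorem tendsto_integral_of_tendsto_moments {ι : Type*} [Countable ι]
    {P : ℕ → Measure (ι → I)} [∀ n, IsProbabilityMeasure (P n)]
    {Q : Measure (ι → I)} [IsProbabilityMeasure Q]
    (hmom : ∀ (k : ℕ) (a : Fin k → ι), Tendsto (fun n => ∫ c, ∏ i, (c (a i) : ℝ) ∂(P n)) atTop
      (𝓝 (∫ c, ∏ i, (c (a i) : ℝ) ∂Q))) (F : C(ι → I, ℝ)) :
    Tendsto (fun n => ∫ c, F c ∂(P n)) atTop (𝓝 (∫ c, F c ∂Q)) := by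
  have hint : ∀ (μ : Measure (ι → I)) [IsProbabilityMeasure μ] (F : C(ι → I, ℝ)),
      Integrable (fun c => F c) μ := fun μ _ F =>
    (BoundedContinuousFunction.mkOfCompact F).integrable μ
  let coord : ι → C(ι → I, ℝ) := fun i => ⟨fun c => (c i : ℝ), by fun_prop⟩
  let A : Subalgebra ℝ C(ι → I, ℝ) := Algebra.adjoin ℝ (range coord)
  have hA : A.SeparatesPoints := by
    intro c d hcd
    obtain ⟨i, hi⟩ := Function.ne_iff.1 hcd
    exact ⟨coord i, ⟨coord i, Algebra.subset_adjoin (mem_range_self i), rfl⟩,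
      fun h => hi (Subtype.ext h)⟩
  have hmon : ∀ F ∈ Submonoid.closure (range coord),
      ∃ (k : ℕ) (a : Fin k → ι), ∀ c, F c = ∏ i, (c (a i) : ℝ) := by
    intro F hF
    induction hF using Submonoid.closure_induction with
    | mem F hF =>
      obtain ⟨i, rfl⟩ := hF
      exact ⟨1, fun _ => i, fun c => by simp [coord]⟩
    | one => exact ⟨0, Fin.elim0, fun c => by simp⟩
    | mul F G _ _ hF hG =>
      obtain ⟨k, a, ha⟩ := hF
      obtain ⟨m, b, hb⟩ := hG
      exact ⟨k + m, Fin.append a b, fun c => by simp [Fin.prod_univ_add, ha, hb]⟩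
  have hpoly : ∀ F ∈ A, Tendsto (fun n => ∫ c, F c ∂(P n)) atTop (𝓝 (∫ c, F c ∂Q)) := by
    intro F hF
    -- The generated algebra is the linear span of the monomials, so linearity reduces the claim to
    -- the moments.
    rw [← Subalgebra.mem_toSubmodule, Algebra.adjoin_eq_span] at hF
    induction hF using Submodule.span_induction with
    | mem F hF =>
      obtain ⟨k, a, ha⟩ := hmon F hF
      simpa only [ha] using hmom k a
    | zero => simp
    | add F G _ _ hF hG =>
      simp only [ContinuousMap.add_apply]
      rw [integral_add (hint Q F) (hint Q G)]
      simp_rw [fun n => integral_add (hint (P n) F) (hint (P n) G)]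
      exact hF.add hG
    | smul r F _ hF =>
      simp only [ContinuousMap.smul_apply, integral_smul]
      exact hF.const_smul r
  refine tendsto_of_forall_approx fun ε hε => ?_
  obtain ⟨⟨G, hG⟩, hGF⟩ :=
    ContinuousMap.exists_mem_subalgebra_near_continuousMap_of_separatesPoints A hA F ε hε
  have hdiff : ∀ (μ : Measure (ι → I)) [IsProbabilityMeasure μ],
      |∫ c, F c ∂μ - ∫ c, G c ∂μ| ≤ ε := by
    intro μ _
    rw [← integral_sub (hint μ F) (hint μ G), ← Real.norm_eq_abs]
    refine (norm_integral_le_of_norm_le_const (C := ε) (ae_of_all _ fun c => ?_)).trans (by simp)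
    rw [norm_sub_rev]
    exact ((G - F).norm_coe_le_norm c).trans hGF.le
  exact ⟨_, _, hpoly G hG, fun n => hdiff (P n), hdiff Q⟩

/-- Two bounded functions which agree on a set of almost full measure have close integrals. -/
theorem abs_integral_sub_integral_le {X : Type*} [MeasurableSpace X] {μ : Measure X}
    [IsProbabilityMeasure μ] {f g : X → ℝ} (hf : Integrable f μ) (hg : Integrable g μ) {M η : ℝ}
    (hfM : ∀ x, |f x| ≤ M) (hgM : ∀ x, |g x| ≤ M) (hM : 0 ≤ M) {K : Set X} (hη : 0 ≤ η)
    (hK : μ Kᶜ ≤ ENNReal.ofReal η) (hfg : ∀ x ∈ K, f x = g x) :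
    |∫ x, f x ∂μ - ∫ x, g x ∂μ| ≤ 2 * M * η := by
  -- The difference vanishes on `K`, so only `Kᶜ` contributes; `K` need not be measurable.
  rw [← integral_sub hf hg, ← Real.norm_eq_abs, ← setIntegral_eq_integral_of_forall_compl_eq_zero
    (s := Kᶜ) (fun x hx => sub_eq_zero.2 (hfg x (not_not.1 hx)))]
  have hr : μ.real Kᶜ ≤ η := ENNReal.toReal_le_of_le_ofReal hη hK
  refine (norm_setIntegral_le_of_norm_le_const (C := 2 * M) (measure_lt_top μ _)
    (fun x _ => ?_)).trans (by gcongr)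
  calc ‖f x - g x‖ ≤ |f x| + |g x| := abs_sub _ _
    _ ≤ 2 * M := by linarith [hfM x, hgM x]

/-- A tight sequence of probability measures converges weakly as soon as the joint moments of a
countable point-separating family of continuous functions converge. -/
theorem weaklyConverges_of_isTight_of_tendsto_moments {X : Type*} [TopologicalSpace X] [T2Space X]
    [MeasurableSpace X] [BorelSpace X] {ι : Type*} [Countable ι] {h : ι → X → I}
    (hc : ∀ i, Continuous (h i)) (hsep : ∀ x y, (∀ i, h i x = h i y) → x = y)
    {P : ℕ → Measure X} [∀ n, IsProbabilityMeasure (P n)]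
    {Q : Measure X} [IsProbabilityMeasure Q] (htight : IsTightMeasureSet (range P))
    (hmom : ∀ (k : ℕ) (a : Fin k → ι), Tendsto (fun n => ∫ x, ∏ i, (h (a i) x : ℝ) ∂(P n)) atTop
      (𝓝 (∫ x, ∏ i, (h (a i) x : ℝ) ∂Q))) :
    WeaklyConverges P Q := by
  let Φ : X → ι → I := fun x i => h i x
  have hΦ : Continuous Φ := continuous_pi hc
  have hΦm : Measurable Φ := hΦ.measurable
  have hinj : Function.Injective Φ := fun x y hxy => hsep x y fun i => congrFun hxy i
  have hmapP : ∀ n, IsProbabilityMeasure ((P n).map Φ) :=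
    fun n => Measure.isProbabilityMeasure_map hΦm.aemeasurable
  have hmapQ : IsProbabilityMeasure (Q.map Φ) :=
    Measure.isProbabilityMeasure_map hΦm.aemeasurable
  have hmap : ∀ (μ : Measure X) (F : C(ι → I, ℝ)),
      ∫ c, F c ∂(μ.map Φ) = ∫ x, F (Φ x) ∂μ := fun μ F =>
    integral_map hΦm.aemeasurable F.continuous.aestronglyMeasurable
  have hcube : ∀ F : C(ι → I, ℝ),
      Tendsto (fun n => ∫ c, F c ∂((P n).map Φ)) atTop (𝓝 (∫ c, F c ∂(Q.map Φ))) := by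
    refine tendsto_integral_of_tendsto_moments fun k a => ?_
    have hprod := fun μ => hmap μ ⟨fun c => ∏ i, (c (a i) : ℝ), by fun_prop⟩
    simp only [ContinuousMap.coe_mk] at hprod
    simp_rw [hprod]
    exact hmom k a
  have hweak : Tendsto (β := ProbabilityMeasure (ι → I)) (fun n => ⟨(P n).map Φ, hmapP n⟩) atTop
      (𝓝 ⟨Q.map Φ, hmapQ⟩) :=
    ProbabilityMeasure.tendsto_iff_forall_integral_tendsto.2 fun f => hcube f.toContinuousMap
  rw [isTightMeasureSet_iff_exists_isCompact_measure_compl_le] at htight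
  have htight' : ∀ ε, 0 < ε → ∃ K : Set X, IsCompact K ∧ (∀ n, P n Kᶜ ≤ ε) ∧ Q Kᶜ ≤ ε := by
    intro ε hε
    obtain ⟨K, hK, hKε⟩ := htight ε hε
    have hPK : ∀ n, P n Kᶜ ≤ ε := fun n => hKε _ (mem_range_self n)
    refine ⟨K, hK, hPK, ?_⟩
    -- The limit inherits the bound: by injectivity `Kᶜ` is the preimage of an open subset of the
    -- cube, and the portmanteau inequality for open sets applies there.
    have hopen : IsOpen (Φ '' K)ᶜ := (hK.image hΦ).isClosed.isOpen_compl
    have hval : ∀ μ : Measure X, μ.map Φ (Φ '' K)ᶜ = μ Kᶜ := fun μ => by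
      rw [Measure.map_apply hΦm hopen.measurableSet, preimage_compl, preimage_image_eq K hinj]
    have hlim := ProbabilityMeasure.le_liminf_measure_open_of_tendsto hweak hopen
    simp only [ProbabilityMeasure.coe_mk, hval] at hlim
    refine hlim.trans ?_
    calc liminf (fun n => P n Kᶜ) atTop ≤ liminf (fun _ : ℕ => ε) atTop :=
          liminf_le_liminf (Eventually.of_forall hPK)
      _ = ε := liminf_const ε
  intro f
  refine tendsto_of_forall_approx fun ε hε => ?_
  -- The `+ 1` covers `f = 0`.
  set η : ℝ := ε / (2 * ‖f‖ + 1) with hη_def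
  have hη : 0 < η := by positivity
  have hηε : 2 * ‖f‖ * η ≤ ε := by
    rw [hη_def, mul_div_assoc', div_le_iff₀ (by positivity)]
    nlinarith [norm_nonneg f]
  obtain ⟨K, hK, hPK, hQK⟩ := htight' (ENNReal.ofReal η) (ENNReal.ofReal_pos.2 hη)
  have : CompactSpace K := isCompact_iff_compactSpace.1 hK
  have hemb : IsClosedEmbedding (fun x : K => Φ x) :=
    (hΦ.comp continuous_subtype_val).isClosedEmbedding (hinj.comp Subtype.val_injective)
  -- Tietze extension of `f` from `Φ '' K` to the cube. Keeping the norm is what controls the error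
  -- off `K`.
  obtain ⟨g, hg, hgf⟩ := BoundedContinuousFunction.exists_extension_norm_eq_of_isClosedEmbedding
    (f.compContinuous ⟨((↑) : K → X), continuous_subtype_val⟩) hemb
  have hgnorm : ‖g‖ ≤ ‖f‖ := hg.trans_le (f.norm_compContinuous_le _)
  have hdiff : ∀ (μ : Measure X) [IsProbabilityMeasure μ], μ Kᶜ ≤ ENNReal.ofReal η →
      |∫ x, f x ∂μ - ∫ c, g c ∂(μ.map Φ)| ≤ ε := by
    intro μ _ hR
    rw [show ∫ c, g c ∂(μ.map Φ) = ∫ x, g (Φ x) ∂μ from hmap μ g.toContinuousMap]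
    refine (abs_integral_sub_integral_le (f.integrable μ)
      ((g.compContinuous ⟨Φ, hΦ⟩).integrable μ) (M := ‖f‖) f.norm_coe_le_norm
      (fun x => (g.norm_coe_le_norm _).trans hgnorm) (norm_nonneg f) hη.le hR
      fun x hx => ?_).trans hηε
    exact (congrFun hgf ⟨x, hx⟩).symm
  exact ⟨_, _, hcube g.toContinuousMap, fun n => hdiff (P n) (hPK n), hdiff Q hQK⟩

/-! ### Right-continuous functions on the unit interval -/

instance : Measure.IsOpenPosMeasure (volume : Measure I) where
  open_pos U hU hne := by
    obtain ⟨a, b, hab, hsub⟩ := hU.exists_Ioo_subset hne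
    refine (lt_of_lt_of_le ?_ (measure_mono hsub)).ne'
    rw [unitInterval.volume_Ioo]
    exact ENNReal.ofReal_pos.2 (sub_pos.2 hab)

/-- The approximant is the first point of the grid of mesh `1 / (n + 1)` strictly to the right of
`s`, clipped to `[0,1]`. It depends on `s` only through a natural number, so measurability of the
approximating step processes reduces to that at countably many fixed times. -/
theorem exists_rightApprox : ∃ ρ : ℕ → ℕ → I, ∀ s : I,
    Tendsto (fun n : ℕ => ρ n ⌊((n : ℝ) + 1) * s⌋₊) atTop (𝓝[≥] s) := by
  refine ⟨fun n m => projIcc 0 1 zero_le_one (((m : ℝ) + 1) / ((n : ℝ) + 1)), fun s => ?_⟩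
  have hs : projIcc (0 : ℝ) 1 zero_le_one s = s := projIcc_val _ s
  have hlow : ∀ n : ℕ, (s : ℝ) ≤ ((⌊((n : ℝ) + 1) * s⌋₊ : ℝ) + 1) / ((n : ℝ) + 1) := fun n => by
    rw [le_div_iff₀ (by positivity), mul_comm]
    exact (Nat.lt_floor_add_one _).le
  have hup : ∀ n : ℕ, ((⌊((n : ℝ) + 1) * s⌋₊ : ℝ) + 1) / ((n : ℝ) + 1)
      ≤ (s : ℝ) + 1 / ((n : ℝ) + 1) := fun n => by
    have h0 := Nat.floor_le (show (0 : ℝ) ≤ ((n : ℝ) + 1) * s from mul_nonneg (by positivity) s.2.1)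
    have hn : (0 : ℝ) < (n : ℝ) + 1 := by positivity
    rw [add_div]
    refine add_le_add_left ((div_le_iff₀ hn).2 ?_) _
    rwa [mul_comm (s : ℝ)]
  refine tendsto_nhdsWithin_iff.2 ⟨?_, Eventually.of_forall fun n => ?_⟩
  · have hlim : Tendsto (fun n : ℕ => (s : ℝ) + 1 / ((n : ℝ) + 1)) atTop (𝓝 s) := by
      simpa using (tendsto_one_div_add_atTop_nhds_zero_nat (𝕜 := ℝ)).const_add (s : ℝ)
    have hproj := (continuous_projIcc (h := zero_le_one (α := ℝ))).tendsto (s : ℝ)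
    rw [hs] at hproj
    exact hproj.comp (tendsto_of_tendsto_of_tendsto_of_le_of_le tendsto_const_nhds hlim hlow hup)
  · have hmono := monotone_projIcc (zero_le_one (α := ℝ)) (hlow n)
    rwa [hs] at hmono

/-- A process with right-continuous paths is jointly measurable. -/
theorem measurable_uncurry_of_rightCont {Ω E : Type*} [MeasurableSpace Ω] [TopologicalSpace E]
    [TopologicalSpace.PseudoMetrizableSpace E] [MeasurableSpace E] [BorelSpace E]
    {Z : I → Ω → E} (hZ : ∀ t, Measurable (Z t))
    (hr : ∀ ω t, ContinuousWithinAt (fun s => Z s ω) (Ici t) t) :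
    Measurable fun p : I × Ω => Z p.1 p.2 := by
  obtain ⟨ρ, hρ⟩ := exists_rightApprox
  have hfloor : ∀ n : ℕ, Measurable fun s : I => ⌊((n : ℝ) + 1) * s⌋₊ := fun n =>
    Nat.measurable_floor.comp (measurable_const.mul measurable_subtype_coe)
  refine measurable_of_tendsto_metrizable
    (f := fun n (p : I × Ω) => Z (ρ n ⌊((n : ℝ) + 1) * p.1⌋₊) p.2) (fun n => ?_)
    (tendsto_pi_nhds.2 fun p => (hr p.2 p.1).tendsto.comp (hρ p.1))
  have hstep : Measurable fun q : ℕ × Ω => Z (ρ n q.1) q.2 :=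
    measurable_from_prod_countable_right fun m => hZ (ρ n m)
  exact hstep.comp (((hfloor n).comp measurable_fst).prodMk measurable_snd)

/-- At such a `t`, the value of `f` exceeds by a gap all values on some `(q, t)` with `q` in a
countable dense set; for each `q` there are only countably many such `t`. -/
theorem countable_setOf_leftLim_lt {f L : I → ℝ} (hL : ∀ t, Tendsto f (𝓝[<] t) (𝓝 (L t))) :
    {t : I | 0 < t ∧ L t < f t}.Countable := by
  obtain ⟨S, hSc, hSd⟩ := TopologicalSpace.exists_countable_dense I
  refine (hSc.biUnion fun q _ => countable_image_lt_image_Iio_within (Ioi q) f).mono ?_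
  rintro t ⟨ht0, ht⟩
  obtain ⟨z, hz1, hz2⟩ := exists_between ht
  obtain ⟨u, hu, hsub⟩ := (mem_nhdsLT_iff_exists_Ioo_subset' ht0).1 ((hL t).eventually_lt_const hz1)
  obtain ⟨q, hq, hqS⟩ := hSd.exists_mem_open isOpen_Ioo (nonempty_Ioo.2 (mem_Iio.1 hu))
  exact mem_biUnion hq
    ⟨hqS.2, z, hz2, fun y hy hyt => le_of_lt (hsub ⟨hqS.1.trans hy, hyt⟩)⟩

theorem countable_setOf_ne_leftLim {f L : I → ℝ} (hL : ∀ t, Tendsto f (𝓝[<] t) (𝓝 (L t))) :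
    {t : I | 0 < t ∧ L t ≠ f t}.Countable := by
  refine ((countable_setOf_leftLim_lt hL).union
    (countable_setOf_leftLim_lt fun t => (hL t).neg)).mono ?_
  rintro t ⟨ht0, ht⟩
  rcases lt_or_gt_of_ne ht with h | h
  · exact Or.inl ⟨ht0, h⟩
  · exact Or.inr ⟨ht0, neg_lt_neg h⟩

/-- A positive value persists to the right of `t`, hence on a whole basic open set, whose integral
would be positive. The end point 1 escapes, since nothing lies to its right. -/
theorem nonpos_of_forall_setIntegral_eq_zero {d : I → ℝ} (hd : Integrable d)
    (hr : ∀ t, ContinuousWithinAt d (Ici t) t)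
    (h : ∀ U ∈ TopologicalSpace.countableBasis I, ∫ s in U, d s = 0) {t : I} (ht : t < 1) :
    d t ≤ 0 := by
  by_contra! hpos
  obtain ⟨u, hu, hsub⟩ := (mem_nhdsGE_iff_exists_Ico_subset' ht).1
    ((hr t).tendsto.eventually_const_lt hpos)
  obtain ⟨s, hs⟩ := nonempty_Ioo.2 (mem_Ioi.1 hu)
  obtain ⟨U, hU, hsU, hUsub⟩ :=
    (TopologicalSpace.isBasis_countableBasis I).exists_subset_of_mem_open hs isOpen_Ioo
  have hUo := TopologicalSpace.isOpen_of_mem_countableBasis hU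
  have hdU : ∀ v ∈ U, 0 < d v := fun v hv => hsub (Ioo_subset_Ico_self (hUsub hv))
  refine (h U hU).not_gt ((setIntegral_pos_iff_support_of_nonneg_ae
    (ae_restrict_of_forall_mem hUo.measurableSet fun v hv => (hdU v hv).le)
    hd.integrableOn).2 ?_)
  rw [inter_eq_right.2 (show U ⊆ Function.support d from fun v hv => (hdU v hv).ne')]
  exact hUo.measure_pos volume ⟨s, hsU⟩

/-! ### Continuity points and evaluation of càdlàg functions -/

namespace Cadlag

variable {E : Type*}

theorem measurable_comp [TopologicalSpace E] {g : E → I} (hg : Continuous g) (x : Cadlag E) :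
    Measurable fun s => (g (x s) : ℝ) := by
  have hr : ∀ t : I, ContinuousWithinAt (fun s => (g (x s) : ℝ)) (Ici t) t := fun t =>
    (continuous_subtype_val.comp hg).continuousAt.comp_continuousWithinAt (x.rightCont t)
  -- A single path is a process on a one-point space.
  have := measurable_uncurry_of_rightCont (Ω := Unit) (Z := fun s _ => (g (x s) : ℝ))
    (fun _ => measurable_const) fun _ => hr
  exact this.comp (measurable_id.prodMk (measurable_const (a := ())))

theorem continuousAt_of_leftLim_eq [TopologicalSpace E] {x : Cadlag E} {t : I}
    (h : Tendsto x (𝓝[<] t) (𝓝 (x t))) : ContinuousAt x t :=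
  continuousAt_iff_continuous_left'_right'.2 ⟨h, (x.rightCont t).mono Ioi_subset_Ici_self⟩

/-- At a discontinuity the left limit differs from the value, and some `G j` sees the difference.
This reduces the claim to countably many real functions. -/
theorem countable_not_continuousAt [TopologicalSpace E] {ι : Type*} [Countable ι] {G : ι → E → I}
    (hG : ∀ j, Continuous (G j)) (hsep : ∀ p q, (∀ j, G j p = G j q) → p = q) (x : Cadlag E) :
    {t | ¬ ContinuousAt x t}.Countable := by
  choose L hL using x.leftLim
  have hGc : ∀ j, Continuous fun p => (G j p : ℝ) := fun j => continuous_subtype_val.comp (hG j)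
  refine (countable_iUnion fun j => countable_setOf_ne_leftLim (f := fun t => (G j (x t) : ℝ))
    (L := fun t => G j (L t)) fun t => ((hGc j).tendsto _).comp (hL t)).mono fun t ht => ?_
  -- At 0 there is no left neighbourhood, so right-continuity alone gives continuity.
  have ht0 : 0 < t := by
    by_contra h0
    have h0' : t = ⊥ := le_antisymm (not_lt.1 h0) bot_le
    refine ht (continuousAt_of_leftLim_eq ?_)
    rw [h0', Iio_bot, nhdsWithin_empty]
    exact tendsto_bot
  have hne : L t ≠ x t := fun h => ht (continuousAt_of_leftLim_eq (h ▸ hL t))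
  obtain ⟨j, hj⟩ : ∃ j, G j (L t) ≠ G j (x t) := by
    by_contra! h
    exact hne (hsep _ _ h)
  exact mem_iUnion.2 ⟨j, ht0, fun h => hj (Subtype.ext h)⟩

/-- Evaluation at a continuity point of `x`, or at the right end point, is continuous at `x`. -/
theorem tendsto_eval [EMetricSpace E] {size : TimeChange → ℝ≥0∞}
    (hsize : ∀ ε : ℝ≥0∞, 0 < ε → ∃ δ > 0, ∀ l : TimeChange, size l < δ →
      TimeChange.uniformSize l < ε)
    {x : Cadlag E} {y : ℕ → Cadlag E}
    (hy : Tendsto (fun n => skorohodEDist size x (y n)) atTop (𝓝 0)) {t : I}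
    (ht : t = 1 ∨ ContinuousAt x t) : Tendsto (fun n => y n t) atTop (𝓝 (x t)) := by
  refine EMetric.tendsto_nhds.2 fun ε hε => ?_
  have hε2 := ENNReal.half_pos hε.ne'
  -- `y n t` is compared with `x` at `l.symm t`. Time changes fix 1, so at that end point any `r`
  -- works.
  obtain ⟨r, hr, H⟩ : ∃ r : ℝ≥0∞, 0 < r ∧ ∀ l : TimeChange, TimeChange.uniformSize l < r →
      edist (x (l.symm t)) (x t) < ε / 2 := by
    rcases ht with rfl | ht
    · refine ⟨1, one_pos, fun l _ => ?_⟩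
      have : l.symm 1 = 1 := l.symm.map_top
      rwa [this, edist_self]
    · obtain ⟨r, hr, H⟩ := EMetric.mem_nhds_iff.1 (EMetric.tendsto_nhds.1 ht _ hε2)
      refine ⟨r, hr, fun l hl => H ?_⟩
      exact (le_iSup (fun s : I => edist (l.symm s) s) t).trans_lt
        ((TimeChange.uniformSize_symm_le l).trans_lt hl)
  obtain ⟨δ, hδ, hδr⟩ := hsize r hr
  filter_upwards [hy.eventually_lt_const (lt_min hδ hε2)] with n hn
  obtain ⟨l, hl⟩ := iInf_lt_iff.1 hn
  have h1 := H l (hδr l ((le_max_left _ _).trans_lt (hl.trans_le (min_le_left _ _))))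
  have h2 := (le_max_right _ _).trans_lt (hl.trans_le (min_le_right _ _))
  have h3 := (le_iSup (fun s : I => edist (x s) (y n (l s))) (l.symm t)).trans_lt h2
  rw [l.apply_symm_apply, edist_comm] at h3
  calc edist (y n t) (x t) ≤ edist (y n t) (x (l.symm t)) + edist (x (l.symm t)) (x t) :=
        edist_triangle _ _ _
    _ < ε / 2 + ε / 2 := ENNReal.add_lt_add h3 h1
    _ = ε := ENNReal.add_halves ε

/-! ### Averages of càdlàg functions -/

/-- A countable family of measures on `[0,1]` which determines a right-continuous function:
the point mass at `1`, and the restrictions of Lebesgue measure to the sets of a countable basis. -/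
noncomputable def weight : Option (TopologicalSpace.countableBasis I) → Measure I
  | none => Measure.dirac 1
  | some U => volume.restrict U

theorem weight_univ_le (o : Option (TopologicalSpace.countableBasis I)) :
    weight o univ ≤ 1 := by
  cases o with
  | none => simp [weight]
  | some U => simpa [weight] using prob_le_one

instance (o : Option (TopologicalSpace.countableBasis I)) : IsFiniteMeasure (weight o) :=
  ⟨(weight_univ_le o).trans_lt ENNReal.one_lt_top⟩

theorem ae_weight {p : I → Prop} (h1 : p 1) (hp : ∀ᵐ s, p s)
    (o : Option (TopologicalSpace.countableBasis I)) : ∀ᵐ s ∂(weight o), p s := by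
  cases o with
  | none => simpa [weight] using h1
  | some U => exact ae_restrict_of_ae hp

/-- The average `∫ g (x s) dν(s)` for `ν` in the family `weight`. -/
noncomputable def avg [TopologicalSpace E] (g : E → I)
    (o : Option (TopologicalSpace.countableBasis I)) (x : Cadlag E) : I :=
  ⟨∫ s, (g (x s) : ℝ) ∂(weight o), integral_nonneg fun s => (g (x s)).2.1, by
    refine (Real.le_norm_self _).trans ((norm_integral_le_of_norm_le_const (C := 1)
      (ae_of_all _ fun s => ?_)).trans ?_)
    · rw [Real.norm_of_nonneg (g (x s)).2.1]
      exact (g (x s)).2.2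
    · rw [one_mul]
      exact ENNReal.toReal_le_of_le_ofReal zero_le_one (by simpa using weight_univ_le o)⟩

/-- Lebesgue averages over basic open sets determine each `G j ∘ x` on `[0,1)` by right-continuity.
They say nothing about the value at 1, which is why the point mass there is included. -/
theorem eq_of_avg_eq [TopologicalSpace E] {ι : Type*} {G : ι → E → I} (hG : ∀ j, Continuous (G j))
    (hsep : ∀ p q, (∀ j, G j p = G j q) → p = q) {x y : Cadlag E}
    (h : ∀ (o : Option (TopologicalSpace.countableBasis I)) (j : ι), avg (G j) o x = avg (G j) o y) :
    x = y := by
  have h' : ∀ o j, ∫ s, (G j (x s) : ℝ) ∂(weight o) = ∫ s, (G j (y s) : ℝ) ∂(weight o) :=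
    fun o j => congrArg Subtype.val (h o j)
  have hGc : ∀ j, Continuous fun p => (G j p : ℝ) := fun j => continuous_subtype_val.comp (hG j)
  have hint : ∀ (j : ι) (z : Cadlag E), Integrable fun s => (G j (z s) : ℝ) := fun j z =>
    Integrable.of_bound (measurable_comp (hG j) z).aestronglyMeasurable 1 (ae_of_all _ fun s => by
      rw [Real.norm_of_nonneg (G j (z s)).2.1]
      exact (G j (z s)).2.2)
  have hr : ∀ (j : ι) (z : Cadlag E) (t : I),
      ContinuousWithinAt (fun s => (G j (z s) : ℝ)) (Ici t) t := fun j z t =>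
    (hGc j).continuousAt.comp_continuousWithinAt (z.rightCont t)
  have hle : ∀ z w : Cadlag E, (∀ o j, ∫ s, (G j (z s) : ℝ) ∂(weight o)
      = ∫ s, (G j (w s) : ℝ) ∂(weight o)) → ∀ (j : ι) (t : I), t < 1 →
      (G j (z t) : ℝ) ≤ G j (w t) := by
    intro z w hzw j t ht
    refine sub_nonpos.1 (nonpos_of_forall_setIntegral_eq_zero ((hint j z).sub (hint j w))
      (fun t => (hr j z t).sub (hr j w t)) (fun U hU => ?_) ht)
    rw [integral_sub' (hint j z).integrableOn (hint j w).integrableOn]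
    exact sub_eq_zero.2 (hzw (some ⟨U, hU⟩) j)
  ext t
  refine hsep _ _ fun j => Subtype.ext ?_
  rcases eq_or_lt_of_le (show t ≤ 1 from t.2.2) with rfl | ht
  · simpa [weight] using h' none j
  · exact le_antisymm (hle x y h' j t ht) (hle y x (fun o j => (h' o j).symm) j t ht)

/-- Dominated convergence: the values converge at 1 and off the countable set of discontinuities of
`x`. Keeping `size` general serves both the metric of `D` and that of `D([0,1]; D)`. -/
theorem tendsto_avg [EMetricSpace E] {size : TimeChange → ℝ≥0∞}
    (hsize : ∀ ε : ℝ≥0∞, 0 < ε → ∃ δ > 0, ∀ l : TimeChange, size l < δ →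
      TimeChange.uniformSize l < ε)
    {ι : Type*} [Countable ι] {G : ι → E → I}
    (hG : ∀ j, Continuous (G j)) (hsep : ∀ p q, (∀ j, G j p = G j q) → p = q)
    {x : Cadlag E} {y : ℕ → Cadlag E}
    (hy : Tendsto (fun n => skorohodEDist size x (y n)) atTop (𝓝 0))
    (o : Option (TopologicalSpace.countableBasis I)) (j : ι) :
    Tendsto (fun n => avg (G j) o (y n)) atTop (𝓝 (avg (G j) o x)) := by
  have hGc : Continuous fun p => (G j p : ℝ) := continuous_subtype_val.comp (hG j)
  refine tendsto_subtype_rng.2 (tendsto_integral_of_dominated_convergence (fun _ => (1 : ℝ))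
    (fun n => (measurable_comp (hG j) (y n)).aestronglyMeasurable) (integrable_const _)
    (fun n => ae_of_all _ fun s => ?_) ?_)
  · rw [Real.norm_of_nonneg (G j (y n s)).2.1]
    exact (G j (y n s)).2.2
  · refine ae_weight (hGc.tendsto _ |>.comp (tendsto_eval hsize hy (Or.inl rfl))) ?_ o
    filter_upwards [(countable_not_continuousAt hG hsep x).ae_notMem volume] with s hs
    exact (hGc.tendsto _).comp (tendsto_eval hsize hy (Or.inr (not_not.1 hs)))

end Cadlag

/-! ### Point-separating families on `D` and `D([0,1]; D)` -/

theorem TimeChange.exists_uniformSize_lt_of_logSize_lt (ε : ℝ≥0∞) (hε : 0 < ε) :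
    ∃ δ > 0, ∀ l : TimeChange, TimeChange.logSize l < δ → TimeChange.uniformSize l < ε := by
  have hcont : Continuous fun c : ℝ => ENNReal.ofReal (Real.exp c - 1) :=
    ENNReal.continuous_ofReal.comp (by fun_prop)
  have hlim : Tendsto (fun c : ℝ => ENNReal.ofReal (Real.exp c - 1)) (𝓝[>] 0) (𝓝 0) := by
    simpa using (hcont.tendsto 0).mono_left nhdsWithin_le_nhds
  obtain ⟨c, hc, hc0⟩ := ((hlim.eventually_lt_const hε).and self_mem_nhdsWithin).exists
  exact ⟨ENNReal.ofReal c, ENNReal.ofReal_pos.2 hc0, fun l hl =>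
    (l.uniformSize_le_of_logSize_le (le_of_lt hc0) hl.le).trans_lt hc⟩

namespace SkorohodD

/-- A countable point-separating family of continuous functions on `D`. -/
noncomputable def test (o : Option (TopologicalSpace.countableBasis I)) : SkorohodD → I :=
  Cadlag.avg unitInterval.sigmoid o

theorem continuous_test (o : Option (TopologicalSpace.countableBasis I)) :
    Continuous (test o) := by
  refine continuous_iff_seqContinuous.2 fun y x hy => ?_
  have hy' : Tendsto (fun n => edist x (y n)) atTop (𝓝 0) := by
    simpa only [edist_comm] using tendsto_iff_edist_tendsto_0.1 hy
  exact Cadlag.tendsto_avg (E := ℝ) TimeChange.exists_uniformSize_lt_of_logSize_lt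
    -- One injective function separates the points of `ℝ`.
    (G := fun _ : Unit => unitInterval.sigmoid) (fun _ => unitInterval.continuous_sigmoid)
    (fun p q h => unitInterval.sigmoid_strictMono.injective (h ())) hy' o ()

theorem eq_of_test_eq {x y : SkorohodD} (h : ∀ o, test o x = test o y) : x = y :=
  Cadlag.eq_of_avg_eq (E := ℝ) (G := fun _ : Unit => unitInterval.sigmoid)
    (fun _ => unitInterval.continuous_sigmoid)
    (fun _ _ h => unitInterval.sigmoid_strictMono.injective (h ())) fun o _ => h o

end SkorohodD

namespace SkorohodDD

theorem tendsto_skorohodEDist {x : SkorohodDD} {y : ℕ → SkorohodDD}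
    (hy : Tendsto y atTop (𝓝 x)) :
    Tendsto (fun n => Cadlag.skorohodEDist (E := SkorohodD) TimeChange.uniformSize x (y n)) atTop
      (𝓝 0) := by
  have hy' : Tendsto (fun n => edist x (y n)) atTop (𝓝 0) := by
    simpa only [edist_comm] using tendsto_iff_edist_tendsto_0.1 hy
  exact hy'

/-- A countable point-separating family of continuous functions on `D([0,1]; D)`. -/
noncomputable def test (o : Option (TopologicalSpace.countableBasis I) ×
    Option (TopologicalSpace.countableBasis I)) : SkorohodDD → I :=
  Cadlag.avg (SkorohodD.test o.2) o.1

theorem continuous_test (o : Option (TopologicalSpace.countableBasis I) ×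
    Option (TopologicalSpace.countableBasis I)) : Continuous (test o) :=
  continuous_iff_seqContinuous.2 fun _ _ hy =>
    Cadlag.tendsto_avg (E := SkorohodD) (fun ε hε => ⟨ε, hε, fun _ h => h⟩)
      SkorohodD.continuous_test (fun _ _ => SkorohodD.eq_of_test_eq) (tendsto_skorohodEDist hy)
      o.1 o.2

theorem eq_of_test_eq {x y : SkorohodDD} (h : ∀ o, test o x = test o y) : x = y :=
  Cadlag.eq_of_avg_eq (E := SkorohodD) SkorohodD.continuous_test
    (fun _ _ => SkorohodD.eq_of_test_eq) fun o j => h (o, j)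

/-! ### The continuity times of a measure -/

theorem continuousAt_proj {x : SkorohodDD} {t : I} (h : ContinuousAt (fun s => proj s x) t) :
    ContinuousAt (proj t) x :=
  tendsto_of_seq_tendsto fun _ hy =>
    Cadlag.tendsto_eval (E := SkorohodD) (fun ε hε => ⟨ε, hε, fun _ h => h⟩)
      (tendsto_skorohodEDist hy) (Or.inr h)

theorem one_mem_contTimes (Q : Measure SkorohodDD) : (1 : I) ∈ contTimes Q :=
  ae_of_all _ fun _ => continuous_proj_one.continuousAt

theorem measurable_uncurry_proj : Measurable fun p : I × SkorohodDD => proj p.1 p.2 :=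
  measurable_uncurry_of_rightCont measurable_proj fun x t => Cadlag.rightCont x t

/-- The time `max (t - 1 / (n + 1)) 0`. -/
noncomputable def leftApprox (n : ℕ) (t : I) : I :=
  projIcc 0 1 zero_le_one ((t : ℝ) - 1 / ((n : ℝ) + 1))

theorem continuous_leftApprox (n : ℕ) : Continuous (leftApprox n) :=
  continuous_projIcc.comp (continuous_subtype_val.sub continuous_const)

theorem tendsto_leftApprox (t : I) : Tendsto (fun n => leftApprox n t) atTop (𝓝 t) := by
  have hlim : Tendsto (fun n : ℕ => (t : ℝ) - 1 / ((n : ℝ) + 1)) atTop (𝓝 t) := by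
    simpa using (tendsto_one_div_add_atTop_nhds_zero_nat (𝕜 := ℝ)).const_sub (t : ℝ)
  have hproj := (continuous_projIcc (h := zero_le_one (α := ℝ))).tendsto (t : ℝ)
  rw [projIcc_val] at hproj
  exact hproj.comp hlim

theorem leftApprox_lt {t : I} (ht : 0 < t) (n : ℕ) : leftApprox n t < t := by
  have hn : (0 : ℝ) < 1 / ((n : ℝ) + 1) := by positivity
  rw [← Subtype.coe_lt_coe, leftApprox, coe_projIcc]
  exact max_lt ht ((min_le_right _ _).trans_lt (sub_lt_self _ hn))

/-- The left limit exists, so one sequence from the left and the separating tests identify it with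
the value. Continuity at `t` thus follows from countably many real limits, a condition jointly
measurable in `(t, x)`. -/
theorem continuousAt_of_tendsto_leftApprox {x : SkorohodDD} {t : I} (ht : 0 < t)
    (h : ∀ o, Tendsto (fun n => SkorohodD.test o (proj (leftApprox n t) x)) atTop
      (𝓝 (SkorohodD.test o (proj t x)))) :
    ContinuousAt (fun s => proj s x) t := by
  obtain ⟨p, hp⟩ := Cadlag.leftLim x t
  have hleft : Tendsto (fun n => leftApprox n t) atTop (𝓝[<] t) :=
    tendsto_nhdsWithin_iff.2 ⟨tendsto_leftApprox t, Eventually.of_forall (leftApprox_lt ht)⟩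
  have hpx : p = proj t x := SkorohodD.eq_of_test_eq fun o =>
    tendsto_nhds_unique (((SkorohodD.continuous_test o).tendsto p).comp (hp.comp hleft)) (h o)
  exact Cadlag.continuousAt_of_leftLim_eq (E := SkorohodD) (x := x)
    (hp.trans_eq (congrArg 𝓝 hpx))

/-- Almost every time is a continuity time. -/
theorem ae_mem_contTimes (Q : Measure SkorohodDD) [IsProbabilityMeasure Q] :
    ∀ᵐ t : I, t ∈ contTimes Q := by
  have hmeas : MeasurableSet {p : I × SkorohodDD | ∀ o,
      Tendsto (fun n => SkorohodD.test o (proj (leftApprox n p.1) p.2)) atTop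
        (𝓝 (SkorohodD.test o (proj p.1 p.2)))} := by
    simp only [ofPred_forall]
    refine MeasurableSet.iInter fun o => measurableSet_tendsto_fun (fun n => ?_)
      ((SkorohodD.continuous_test o).measurable.comp measurable_uncurry_proj)
    exact (SkorohodD.continuous_test o).measurable.comp (measurable_uncurry_proj.comp
      (((continuous_leftApprox n).measurable.comp measurable_fst).prodMk measurable_snd))
  have hae : ∀ᵐ t : I, ∀ᵐ x ∂Q, ∀ o,
      Tendsto (fun n => SkorohodD.test o (proj (leftApprox n t) x)) atTop
        (𝓝 (SkorohodD.test o (proj t x))) := by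
    -- After exchanging the quantifiers by Fubini, the path is fixed and has only countably many
    -- discontinuities.
    refine (Measure.ae_ae_comm hmeas).2 (ae_of_all _ fun x => ?_)
    filter_upwards [(Cadlag.countable_not_continuousAt (E := SkorohodD) SkorohodD.continuous_test
      (fun _ _ => SkorohodD.eq_of_test_eq) x).ae_notMem volume] with t ht o
    exact ((SkorohodD.continuous_test o).tendsto _).comp
      ((not_not.1 ht).tendsto.comp (tendsto_leftApprox t))
  -- Time 0 is discarded as a null set, since `leftApprox n 0` is not strictly to its left.
  filter_upwards [hae, (countable_singleton (0 : I)).ae_notMem volume] with t ht ht0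
  have hpos : 0 < t := lt_of_le_of_ne t.2.1 (Ne.symm ht0)
  filter_upwards [ht] with x hx
  exact continuousAt_proj (continuousAt_of_tendsto_leftApprox hpos hx)

/-! ### Convergence of moments -/

section moments

variable {k : ℕ} (a : Fin k → Option (TopologicalSpace.countableBasis I) ×
  Option (TopologicalSpace.countableBasis I))

theorem norm_prod_test_le (y : Fin k → SkorohodD) :
    ‖∏ i, (SkorohodD.test (a i).2 (y i) : ℝ)‖ ≤ 1 := by
  rw [Real.norm_of_nonneg (Finset.prod_nonneg fun i _ => (SkorohodD.test (a i).2 (y i)).2.1)]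
  exact Finset.prod_le_one (fun i _ => (SkorohodD.test (a i).2 (y i)).2.1)
    fun i _ => (SkorohodD.test (a i).2 (y i)).2.2

theorem measurable_prod_test :
    Measurable fun y : Fin k → SkorohodD => ∏ i, (SkorohodD.test (a i).2 (y i) : ℝ) :=
  Finset.measurable_fun_prod _ fun i _ => measurable_subtype_coe.comp
    ((SkorohodD.continuous_test (a i).2).measurable.comp (measurable_pi_apply i))

theorem integrable_prod_test (μ : Measure SkorohodDD) [IsProbabilityMeasure μ] :
    Integrable (fun p : SkorohodDD × (Fin k → I) =>
      ∏ i, (SkorohodD.test (a i).2 (projs p.2 p.1 i) : ℝ))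
      (μ.prod (Measure.pi fun i => Cadlag.weight (a i).1)) := by
  have hm : Measurable fun p : SkorohodDD × (Fin k → I) => projs p.2 p.1 :=
    measurable_pi_lambda _ fun i => measurable_uncurry_proj.comp
      (g := fun p : I × SkorohodDD => proj p.1 p.2)
      (f := fun p : SkorohodDD × (Fin k → I) => (p.2 i, p.1))
      (((measurable_pi_apply i).comp measurable_snd).prodMk measurable_fst)
  exact Integrable.of_bound ((measurable_prod_test a).comp hm).aestronglyMeasurable 1
    (ae_of_all _ fun p => norm_prod_test_le a _)

/-- A product of time averages is one average over the product of the weights; Fubini then moves the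
expectation inside, where only finitely many times occur. -/
theorem integral_prod_test (μ : Measure SkorohodDD) [IsProbabilityMeasure μ] :
    ∫ x, ∏ i, (test (a i) x : ℝ) ∂μ = ∫ s, ∫ x, ∏ i, (SkorohodD.test (a i).2 (projs s x i) : ℝ) ∂μ
      ∂(Measure.pi fun i => Cadlag.weight (a i).1) := by
  rw [← integral_integral_swap (integrable_prod_test a μ)]
  refine integral_congr_ae (ae_of_all _ fun x => ?_)
  exact (integral_fintype_prod_eq_prod fun i s => (SkorohodD.test (a i).2 (proj s x) : ℝ)).symm

theorem tendsto_integral_prod_test {P : ℕ → Measure SkorohodDD} [∀ n, IsProbabilityMeasure (P n)]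
    {Q : Measure SkorohodDD} [IsProbabilityMeasure Q]
    (hfd : ∀ (k : ℕ) (t : Fin k → I), (∀ i, t i ∈ contTimes Q) →
      WeaklyConverges (fun n => (P n).map (projs t)) (Q.map (projs t))) :
    Tendsto (fun n => ∫ x, ∏ i, (test (a i) x : ℝ) ∂(P n)) atTop
      (𝓝 (∫ x, ∏ i, (test (a i) x : ℝ) ∂Q)) := by
  simp_rw [integral_prod_test]
  refine tendsto_integral_of_dominated_convergence (fun _ => (1 : ℝ))
    (fun n => (integrable_prod_test a (P n)).integral_prod_right.aestronglyMeasurable)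
    (integrable_const _) (fun n => ae_of_all _ fun s => ?_) ?_
  · exact (norm_integral_le_of_norm_le_const (ae_of_all _ fun x => norm_prod_test_le a _)).trans
      (by simp)
  -- Null sets of times pull back to null sets under each coordinate; the atom at 1 is harmless
  -- because 1 is always a continuity time.
  · have hs : ∀ᵐ s ∂(Measure.pi fun i => Cadlag.weight (a i).1), ∀ i, s i ∈ contTimes Q :=
      ae_all_iff.2 fun i => (Measure.quasiMeasurePreserving_eval _ i).ae
        (Cadlag.ae_weight (one_mem_contTimes Q) (ae_mem_contTimes Q) _)
    filter_upwards [hs] with s hs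
    have hcont : Continuous fun y : Fin k → SkorohodD =>
        ∏ i, (SkorohodD.test (a i).2 (y i) : ℝ) :=
      continuous_finsetProd _ fun i _ => continuous_subtype_val.comp
        ((SkorohodD.continuous_test (a i).2).comp (continuous_apply i))
    have hlim := hfd k s hs
      (BoundedContinuousFunction.ofNormedAddCommGroup _ hcont 1 (norm_prod_test_le a))
    have hmap : ∀ μ : Measure SkorohodDD,
        ∫ y, ∏ i, (SkorohodD.test (a i).2 (y i) : ℝ) ∂(μ.map (projs s))
          = ∫ x, ∏ i, (SkorohodD.test (a i).2 (projs s x i) : ℝ) ∂μ := fun μ =>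
      integral_map (measurable_projs s).aemeasurable (measurable_prod_test a).aestronglyMeasurable
    simpa only [BoundedContinuousFunction.coe_ofNormedAddCommGroup, hmap] using hlim

end moments

end SkorohodDD

theorem mainTheorem6 (P : ℕ → Measure SkorohodDD) [∀ n, IsProbabilityMeasure (P n)]
    (Q : Measure SkorohodDD) [IsProbabilityMeasure Q]
    (hfd : ∀ (k : ℕ) (t : Fin k → I), (∀ i, t i ∈ SkorohodDD.contTimes Q) →
      WeaklyConverges (fun n => (P n).map (SkorohodDD.projs t)) (Q.map (SkorohodDD.projs t)))
    (htight : IsTightMeasureSet (Set.range P)) :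
    WeaklyConverges P Q :=
  weaklyConverges_of_isTight_of_tendsto_moments SkorohodDD.continuous_test
    (fun _ _ => SkorohodDD.eq_of_test_eq) htight
    fun _ a => SkorohodDD.tendsto_integral_prod_test a hfd
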